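/- **Theorem 3.4.** Let $\lambda$ be a regular cardinal and let $\mathcal V$ be a symmetric monoidal closed category with unit $I$ which is locally $\lambda$-presentable as a symmetric monoidal closed category: the underlying category $\mathcal V_0$ is locally $\lambda$-presentable, $I$ is $\lambda$-presentable, and $X\otimes Y$ is $\lambda$-presentable whenever $X$ and $Y$ are. Let $K:\mathcal V_\lambda\to\mathcal V$ be the inclusion of the full sub-$\mathcal V$-category of $\lambda$-presentable objects. *Theories.* A $\mathcal V_\lambda$-pretheory is an identity-on-objects $\mathcal V$-functor $J:\mathcal V_\lambda\to\mathcal T$. A $\mathcal T$-algebra is an object $A$ of $\mathcal V$ with a $\mathcal V$-functor $\hat A:\mathcal T^{\mathrm{op}}\to\mathcal V$ such that $\hat A J^{\mathrm{op}}=\mathcal V(K-,A)$; these form a $\mathcal V$-category $\mathrm{Alg}(\mathcal T)$ with forgetful $\mathcal V$-functor $U:\mathrm{Alg}(\mathcal T)\to\mathcal V$. The pretheory is a $\lambda$-ary $\mathcal V$-theory if it is given by free $\mathcal T$-algebras over $\mathcal V_\lambda$: every $Y\in\mathcal V_\lambda$ has a free algebra $FY$ (in the enriched sense), and the canonical morphisms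 $\mathcal T(X,Y)\to\mathcal V(X,UFY)\cong\mathrm{Alg}(\mathcal T)(FX,FY)$ are isomorphisms for all $X,Y\in\mathcal V_\lambda$. *Discreteness.* For $X$ in $\mathcal V$ let $X_0=\mathcal V_0(I,X)\cdot I$ be the coproduct of $\mathcal V_0(I,X)$ copies of $I$, and let $\delta_X:X_0\to X$ be the morphism whose component at $x:I\to X$ is $x$. A morphism $f$ of $\mathcal V_0$ is a *surjection* if the map $\mathcal V_0(I,f)$ is surjective. Let $\mathcal T$ be a $\lambda$-ary $\mathcal V$-theory. Then $U$ has a left $\mathcal V$-adjoint $F$, and for every such $F$ the induced $\mathcal V$-monad $T=UF$ preserves $\lambda$-filtered colimits. Call $\mathcal T$ *discrete* if for every $\lambda$-presentable $X$ every morphism $f:JI\to JX$ of $\mathcal T$ factors through $J(\delta_X):JX_0\to JX$; here, as $X_0$ need not be $\lambda$-presentable, $J$ is extended to all objects by free algebras, that is, the condition is that the morphism $FI\to FX$ corresponding to $f$ equals $F(\delta_X)\,g$ for some $g:FI\to FX_0$ in $\mathrm{Alg}(\mathcal T)$. Then $$\mathcal T\text{ is discrete}\iff T\text{ preserves surjections}.$$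 In particular, if $X_0$ is $\lambda$-presentable for every $\lambda$-presentable $X$, then $T$ preserves surjections if and only if every morphism $JI\to JX$ of $\mathcal T$, with $X$ $\lambda$-presentable, equals $J(\delta_X)\,g$ for some morphism $g:JI\to JX_0$ of $\mathcal T$. -/

import Mathlib

open CategoryTheory CategoryTheory.Limits CategoryTheory.MonoidalCategory

universe w u

namespace DiscreteTheory

/-! ### The base of enrichment -/

section Base

variable (C : Type u) [Category.{w} C] [MonoidalCategory C] (κ : Cardinal.{w}) [Fact κ.IsRegular]

/-- Local `κ`-presentability of a (symmetric) monoidal (closed) category: the underlying category is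
locally `κ`-presentable, the unit object is `κ`-presentable, and the `κ`-presentable objects are
closed under the tensor product. -/
class IsLocallyPresentableMonoidal : Prop extends IsCardinalLocallyPresentable C κ where
  unit_presentable : IsCardinalPresentable (𝟙_ C) κ
  tensor_presentable (X Y : C) [IsCardinalPresentable X κ] [IsCardinalPresentable Y κ] :
    IsCardinalPresentable (X ⊗ Y) κ

/-- The arities: the (essentially small) full subcategory of `κ`-presentable objects. -/
abbrev Arity : Type u := (isCardinalPresentable C κ).FullSubcategory

/-- The unit object as an arity. -/
def Arity.unit [IsLocallyPresentableMonoidal C κ] : Arity C κ :=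
  ⟨𝟙_ C, IsLocallyPresentableMonoidal.unit_presentable⟩

/-- A surjection is a morphism `f` such that `C(I, f)` is a surjective map. -/
def surjections : MorphismProperty C :=
  fun A _ f ↦ Function.Surjective (fun x : 𝟙_ C ⟶ A ↦ x ≫ f)

/-- A functor preserves surjections if it sends surjections to surjections. -/
def PreservesSurjections (G : C ⥤ C) : Prop :=
  ∀ ⦃A B : C⦄ (f : A ⟶ B), surjections C f → surjections C (G.map f)

variable {C} [HasCoproducts.{w} C]

/-- The discrete object `X₀ = C(I, X) · I`, the coproduct of `C(I, X)` copies of the unit. -/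
noncomputable def discreteObj (X : C) : C := ∐ fun _ : 𝟙_ C ⟶ X ↦ 𝟙_ C

/-- The canonical morphism `δ_X : X₀ ⟶ X`, whose component at `x : I ⟶ X` is `x`. -/
noncomputable def δ (X : C) : discreteObj X ⟶ X := Sigma.desc fun x : 𝟙_ C ⟶ X ↦ x

end Base

/-! ### Pretheories and their algebras -/

variable (C : Type u) [Category.{w} C] [MonoidalCategory C] [MonoidalClosed C]
  (κ : Cardinal.{w}) [Fact κ.IsRegular]

/-- A pretheory with the `κ`-presentable objects as arities: a `C`-enriched category `𝒯` on the class
of arities together with an identity-on-objects `C`-functor `J` from the full sub-`C`-category of `C`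
on the arities (with hom-objects the internal homs) to `𝒯`. -/
structure Pretheory where
  /-- The `C`-category `𝒯`; its objects are the arities. -/
  cat : EnrichedCategory C (Arity C κ)
  /-- The action of `J` on hom-objects. -/
  J (X Y : Arity C κ) : (ihom X.obj).obj Y.obj ⟶ cat.Hom X Y
  J_id (X : Arity C κ) : MonoidalClosed.id X.obj ≫ J X X = cat.id X
  J_comp (X Y Z : Arity C κ) :
    MonoidalClosed.comp X.obj Y.obj Z.obj ≫ J X Z = (J X Y ⊗ₘ J Y Z) ≫ cat.comp X Y Z

variable {C κ}

namespace Pretheory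

variable (T : Pretheory C κ)

/-- The underlying morphism `J f : J X ⟶ J Y` in `𝒯` of a morphism `f : X ⟶ Y` between arities. -/
def mapJ {X Y : Arity C κ} (f : X.obj ⟶ Y.obj) : 𝟙_ C ⟶ T.cat.Hom X Y :=
  MonoidalClosed.curry' f ≫ T.J X Y

/-- Composition of morphisms in the underlying ordinary category of `𝒯`. -/
def underlyingComp {X Y Z : Arity C κ} (f : 𝟙_ C ⟶ T.cat.Hom X Y) (g : 𝟙_ C ⟶ T.cat.Hom Y Z) :
    𝟙_ C ⟶ T.cat.Hom X Z :=
  (λ_ (𝟙_ C)).inv ≫ (f ⊗ₘ g) ≫ T.cat.comp X Y Z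

/-- A `𝒯`-algebra: an object `A` of `C` with a `C`-functor `Â : 𝒯ᵒᵖ ⥤ C` such that `Â ∘ Jᵒᵖ` equals
`C(K -, A)`. Thus `Â X` is the internal hom `[X, A]`, and the effect of `Â` on hom-objects
`𝒯(X, Y) ⟶ [[Y, A], [X, A]]` is given by its transpose `act X Y : 𝒯(X, Y) ⊗ [Y, A] ⟶ [X, A]`.
The fields `id_act` and `comp_act` are functoriality of `Â`, and `J_act` says that `Â ∘ Jᵒᵖ` acts on
hom-objects in the same way as `C(K -, A)`, that is, by composition in `C`. -/
structure Algebra where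
  /-- The underlying object `A`. -/
  carrier : C
  /-- The (transposed) effect of the `C`-functor `Â` on hom-objects. -/
  act (X Y : Arity C κ) :
    T.cat.Hom X Y ⊗ (ihom Y.obj).obj carrier ⟶ (ihom X.obj).obj carrier
  id_act (X : Arity C κ) :
    (λ_ ((ihom X.obj).obj carrier)).inv ≫ T.cat.id X ▷ _ ≫ act X X = 𝟙 _
  comp_act (X Y Z : Arity C κ) :
    T.cat.comp X Y Z ▷ (ihom Z.obj).obj carrier ≫ act X Z =
      (α_ _ _ _).hom ≫ T.cat.Hom X Y ◁ act Y Z ≫ act X Y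
  J_act (X Y : Arity C κ) :
    T.J X Y ▷ (ihom Y.obj).obj carrier ≫ act X Y = MonoidalClosed.comp X.obj Y.obj carrier

namespace Algebra

variable {T}

/-- Morphisms of the underlying ordinary category of `Alg(𝒯)`: morphisms `f : A ⟶ B` of `C` such that
the morphisms `[X, f]` are natural in `X` with respect to `𝒯`. -/
@[ext]
structure Hom (A B : T.Algebra) where
  /-- The underlying morphism. -/
  hom : A.carrier ⟶ B.carrier
  comm (X Y : Arity C κ) :
    A.act X Y ≫ (ihom X.obj).map hom = T.cat.Hom X Y ◁ (ihom Y.obj).map hom ≫ B.act X Y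

instance : Category T.Algebra where
  Hom A B := Hom A B
  id A := { hom := 𝟙 _, comm := by intros; simp }
  comp f g :=
    { hom := f.hom ≫ g.hom
      comm := by
        intro X Y
        rw [Functor.map_comp, ← Category.assoc, f.comm, Category.assoc, g.comm]
        simp }

/-- `h : Z ⟶ [A, B]` corresponds to a morphism `Z ⟶ Alg(𝒯)(A, B)` into the hom-object of the
`C`-category `Alg(𝒯)`, i.e. to a family `Z ⟶ [[X, A], [X, B]]` which is `C`-natural in `X ∈ 𝒯` and is
induced by a single morphism `h`. Hence `Z ↦ {h : Z ⟶ [A, B] // IsGradedHom h}` is the functor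
represented by the hom-object `Alg(𝒯)(A, B)`; for `Z = I` one gets the ordinary morphisms above. -/
def IsGradedHom (A B : T.Algebra) {Z : C} (h : Z ⟶ (ihom A.carrier).obj B.carrier) : Prop :=
  ∀ X Y : Arity C κ,
    A.act X Y ▷ Z ≫ (_ ◁ h) ≫ MonoidalClosed.comp X.obj A.carrier B.carrier =
      (α_ _ _ _).hom ≫
        T.cat.Hom X Y ◁ ((_ ◁ h) ≫ MonoidalClosed.comp Y.obj A.carrier B.carrier) ≫ B.act X Y

/-- `F` is the free `𝒯`-algebra on `X` with unit `η : X ⟶ F`, in the enriched sense: for each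
algebra `A`, the canonical morphism `Alg(𝒯)(F, A) ⟶ [F, A] ⟶ [X, A]` is an isomorphism of `C`
(expressed on generalized elements of all shapes `Z`). -/
def IsFree (F : T.Algebra) {X : C} (η : X ⟶ F.carrier) : Prop :=
  ∀ (A : T.Algebra) (Z : C) (g : Z ⟶ (ihom X).obj A.carrier),
    ∃! h : Z ⟶ (ihom F.carrier).obj A.carrier,
      IsGradedHom F A h ∧ h ≫ (MonoidalClosed.pre η).app A.carrier = g

/-- Evaluation of the operations `𝒯(X, Y)` at an element `y : Y ⟶ A` of an algebra, as a morphism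
`𝒯(X, Y) ⟶ [X, A]` of `C`. -/
def eval (A : T.Algebra) (X Y : Arity C κ) (y : Y.obj ⟶ A.carrier) :
    T.cat.Hom X Y ⟶ (ihom X.obj).obj A.carrier :=
  (ρ_ _).inv ≫ T.cat.Hom X Y ◁ MonoidalClosed.curry' y ≫ A.act X Y

/-- The interpretation of an operation `f : J X ⟶ J Y` of `𝒯` in an algebra `A`, taking elements
`Y ⟶ A` to elements `X ⟶ A`. -/
def interp (A : T.Algebra) {X Y : Arity C κ} (f : 𝟙_ C ⟶ T.cat.Hom X Y)
    (y : Y.obj ⟶ A.carrier) : X.obj ⟶ A.carrier :=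
  MonoidalClosed.uncurry' (f ≫ A.eval X Y y)

end Algebra

/-- The underlying ordinary functor `U : Alg(𝒯) ⥤ C` of the forgetful `C`-functor. -/
def forget : T.Algebra ⥤ C where
  obj A := A.carrier
  map f := f.hom

/-- A pretheory is a theory if it is given by the free `𝒯`-algebras over the arities: each arity `Y`
has a free `𝒯`-algebra `FY`, and the canonical comparison morphism
`𝒯(X, Y) ⟶ [X, U F Y] ≅ Alg(𝒯)(FX, FY)`, evaluation of operations at the generic element
`η : Y ⟶ U F Y`, is an isomorphism for all arities `X`. -/
def IsTheory : Prop :=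
  ∀ Y : Arity C κ, ∃ (F : T.Algebra) (η : Y.obj ⟶ F.carrier),
    F.IsFree η ∧ ∀ X : Arity C κ, IsIso (F.eval X Y η)

/-- A left `C`-adjoint `F` of the forgetful `C`-functor `U : Alg(𝒯) ⥤ C`: a left adjoint on the
underlying ordinary categories for which the canonical morphisms `Alg(𝒯)(FX, A) ⟶ [X, U A]` are
isomorphisms of `C`. -/
structure FreeAlgebras where
  /-- The free algebra functor. -/
  F : C ⥤ T.Algebra
  /-- The ordinary adjunction. -/
  adj : F ⊣ T.forget
  isFree (X : C) : Algebra.IsFree (F.obj X) (adj.unit.app X)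

namespace FreeAlgebras

variable {T} (L : T.FreeAlgebras)

/-- The (underlying ordinary monad of the) `C`-monad `U F` on `C` induced by `𝒯`. -/
def monad : Monad C := L.adj.toMonad

/-- The morphism `FX ⟶ FY` of free algebras given by a morphism `J X ⟶ J Y` of `𝒯`. -/
def homOfOp {X Y : Arity C κ} (f : 𝟙_ C ⟶ T.cat.Hom X Y) :
    L.F.obj X.obj ⟶ L.F.obj Y.obj :=
  (L.adj.homEquiv X.obj (L.F.obj Y.obj)).symm
    ((L.F.obj Y.obj).interp f (L.adj.unit.app Y.obj))

end FreeAlgebras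

variable [IsLocallyPresentableMonoidal C κ] [HasCoproducts.{w} C]

/-- Discreteness of `𝒯`: each operation `J I ⟶ J X` factors through `J δ_X : J X₀ ⟶ J X`. Here `X₀`
need not be `κ`-presentable, so `J` is extended to all objects of `C` by free algebras: through the
embedding of `𝒯` as the full subcategory of `Alg(𝒯)` on the free algebras over the arities, the
factorization is one of morphisms `F I ⟶ F X₀ ⟶ F X` of `Alg(𝒯)`. -/
def IsDiscrete (L : T.FreeAlgebras) : Prop :=
  ∀ (X : Arity C κ) (f : 𝟙_ C ⟶ T.cat.Hom (Arity.unit C κ) X),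
    ∃ g : L.F.obj (𝟙_ C) ⟶ L.F.obj (discreteObj X.obj), g ≫ L.F.map (δ X.obj) = L.homOfOp f

/-- Discreteness of `𝒯`, expressed inside `𝒯`, when all `X₀` for `κ`-presentable `X` are again
`κ`-presentable: each `f : J I ⟶ J X` is a composite of some `g : J I ⟶ J X₀` with `J δ_X`. -/
def IsDiscreteInside (h : ∀ X : Arity C κ, IsCardinalPresentable (discreteObj X.obj) κ) : Prop :=
  ∀ (X : Arity C κ) (f : 𝟙_ C ⟶ T.cat.Hom (Arity.unit C κ) X),
    ∃ g : 𝟙_ C ⟶ T.cat.Hom (Arity.unit C κ) ⟨discreteObj X.obj, h X⟩,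
      T.underlyingComp g (T.mapJ (X := ⟨discreteObj X.obj, h X⟩) (Y := X) (δ X.obj)) = f

end Pretheory

end DiscreteTheory

/-! A morphism `F I ⟶ F X` of algebras is a point of `T X`, where `T = U F`. For an arity `X`, being
a theory makes every point of `T X` come from a unique operation `J I ⟶ J X`
(`interp_unit_bijective`), so discreteness says that each `T δ_X` is a surjection
(`isDiscrete_iff`). As `δ_X` is itself a surjection, preservation of surjections gives discreteness.
Conversely, let `q : A ⟶ B` be a surjection and `x` a point of `T B`. Write `B` as a `κ`-filtered
colimit of arities; `T` preserves it and `I` is presentable, so `x` comes from a point of `T X`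
along some `b : X ⟶ B`. Discreteness lifts that point to `T X₀`, and `δ_X ≫ b` lifts through `q`
because `X₀` is a coproduct of copies of `I`. Existence and accessibility of `T` rest on one fact:
arities are closed under tensor, so internal homs out of them preserve `κ`-filtered colimits, and
such colimits of algebras are formed on carriers. Free algebras, and by `IsFree.of_isColimit` their
enriched universal property, then extend from arities to all objects. -/

namespace DiscreteTheory

/-! ### Accessibility of right adjoints and internal homs. -/

section Accessibility

/-- A right adjoint is `κ`-accessible if its left adjoint sends a `κ`-filtered generator to
`κ`-presentable objects. -/
lemma isCardinalAccessible_of_adjunction {C : Type*} [Category* C] {D : Type*} [Category* D]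
    (κ : Cardinal.{w}) [Fact κ.IsRegular] {L : C ⥤ D} {R : D ⥤ C} (adj : L ⊣ R)
    [HasColimitsOfSize.{w, w} C] {P : ObjectProperty C} (hP : P.IsCardinalFilteredGenerator κ)
    (hL : ∀ X, P X → IsCardinalPresentable (L.obj X) κ) :
    R.IsCardinalAccessible κ where
  preservesColimitOfShape J _ _ := by
    have := isFiltered_of_isCardinalFiltered J κ
    refine ⟨fun {K} ↦ ⟨fun {c} hc ↦ ⟨?_⟩⟩⟩
    let φ : colimit (K ⋙ R) ⟶ R.obj c.pt := colimit.desc (K ⋙ R) (R.mapCocone c)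
    have hφ (j : J) : colimit.ι (K ⋙ R) j ≫ φ = R.map (c.ι.app j) := by simp [φ]
    have hsurj (X : C) (hX : P X) (g : X ⟶ R.obj c.pt) : ∃ f, f ≫ φ = g := by
      have := hL X hX
      obtain ⟨j, f, hf⟩ := IsCardinalPresentable.exists_hom_of_isColimit κ hc
        ((adj.homEquiv _ _).symm g)
      refine ⟨adj.homEquiv _ _ f ≫ colimit.ι (K ⋙ R) j, ?_⟩
      rw [Category.assoc, hφ, ← adj.homEquiv_naturality_right, hf]
      exact Equiv.apply_symm_apply _ _
    -- Two maps into the colimit factor through stages of `K ⋙ R`. If `φ` equalizes them, their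
    -- transposes out of the presentable `L.obj X` agree at a later stage of `K`.
    have : Mono φ := by
      rw [hP.isStrongGenerator.isSeparating.mono_iff]
      intro X hX g₁ g₂ h
      have := hP.le_isCardinalPresentable X hX
      rw [isCardinalPresentable_iff] at this
      have := hL X hX
      obtain ⟨j₁, f₁, rfl⟩ :=
        IsCardinalPresentable.exists_hom_of_isColimit κ (colimit.isColimit (K ⋙ R)) g₁
      obtain ⟨j₂, f₂, rfl⟩ :=
        IsCardinalPresentable.exists_hom_of_isColimit κ (colimit.isColimit (K ⋙ R)) g₂
      dsimp at f₁ f₂ h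
      simp only [Category.assoc, hφ] at h
      obtain ⟨j, u, v, huv⟩ := IsCardinalPresentable.exists_eq_of_isColimit κ hc
        ((adj.homEquiv _ _).symm f₁) ((adj.homEquiv _ _).symm f₂) (by
          rw [← adj.homEquiv_naturality_right_symm, ← adj.homEquiv_naturality_right_symm, h]
          rfl)
      rw [← adj.homEquiv_naturality_right_symm, ← adj.homEquiv_naturality_right_symm] at huv
      replace huv := (adj.homEquiv _ _).symm.injective huv
      dsimp
      rw [← colimit.w (K ⋙ R) u, ← colimit.w (K ⋙ R) v]
      simpa using congr($huv ≫ colimit.ι (K ⋙ R) j)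
    have : IsIso φ := hP.isStrongGenerator.isIso_of_mono _ hsurj
    exact IsColimit.ofIsoColimit (colimit.isColimit (K ⋙ R)) (Cocone.ext (asIso φ) hφ)

variable {C : Type u} [Category.{w} C] [MonoidalCategory C] [MonoidalClosed C]
  (κ : Cardinal.{w}) [Fact κ.IsRegular] [IsLocallyPresentableMonoidal C κ]

/-- Internal homs out of `κ`-presentable objects are `κ`-accessible. -/
instance ihom_isCardinalAccessible (X : Arity C κ) : (ihom X.obj).IsCardinalAccessible κ := by
  obtain ⟨P, _, hP⟩ := HasCardinalFilteredGenerator.exists_generator C κ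
  refine isCardinalAccessible_of_adjunction κ (ihom.adjunction X.obj) hP fun Y hY ↦ ?_
  have := hP.le_isCardinalPresentable Y hY
  rw [isCardinalPresentable_iff] at this
  exact IsLocallyPresentableMonoidal.tensor_presentable X.obj Y

end Accessibility

/-! ### Tensors and internal homs of colimits. -/

section Tensor

lemma whiskerLeft_ihom_map_hom_ext {C : Type u} [Category.{w} C] [MonoidalCategory C]
    [MonoidalClosed C] {K : Type*} [Category* K] {G : K ⥤ C} {c : Cocone G} (hc : IsColimit c)
    {P Y W : C} [PreservesColimitsOfShape K (ihom Y)]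
    {f g : P ⊗ (ihom Y).obj c.pt ⟶ W}
    (h : ∀ k, P ◁ (ihom Y).map (c.ι.app k) ≫ f = P ◁ (ihom Y).map (c.ι.app k) ≫ g) : f = g :=
  (isColimitOfPreserves (ihom Y ⋙ tensorLeft P) hc).hom_ext h

variable {C : Type u} [Category.{w} C] [MonoidalCategory C] [SymmetricCategory C] [MonoidalClosed C]

/-- Closedness makes only `tensorLeft Z` a left adjoint; the braiding transfers preservation to the
other side, where the shape `Z` of a generalized element sits. -/
instance tensorRight_preservesColimitsOfShape {K : Type*} [Category* K] (Z : C) :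
    PreservesColimitsOfShape K (tensorRight Z) :=
  preservesColimitsOfShape_of_natIso (BraidedCategory.tensorLeftIsoTensorRight Z)

variable {K : Type*} [Category* K] {G : K ⥤ C} {c : Cocone G} (hc : IsColimit c)

include hc

lemma whiskerLeft_ihom_map_whiskerRight_hom_ext {P Y Z W : C} [PreservesColimitsOfShape K (ihom Y)]
    {f g : (P ⊗ (ihom Y).obj c.pt) ⊗ Z ⟶ W}
    (h : ∀ k, (P ◁ (ihom Y).map (c.ι.app k)) ▷ Z ≫ f =
      (P ◁ (ihom Y).map (c.ι.app k)) ▷ Z ≫ g) : f = g :=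
  (isColimitOfPreserves ((ihom Y ⋙ tensorLeft P) ⋙ tensorRight Z) hc).hom_ext h

lemma pre_hom_ext {Z A : C} {f g : Z ⟶ (ihom c.pt).obj A}
    (h : ∀ k, f ≫ (MonoidalClosed.pre (c.ι.app k)).app A =
      g ≫ (MonoidalClosed.pre (c.ι.app k)).app A) : f = g := by
  apply MonoidalClosed.uncurry_injective
  refine (isColimitOfPreserves (tensorRight Z) hc).hom_ext fun k ↦ ?_
  have := congr(MonoidalClosed.uncurry $(h k))
  rwa [MonoidalClosed.uncurry_pre_app, MonoidalClosed.uncurry_pre_app] at this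

/-- With `pre_hom_ext`, this says that `[-, A]` turns colimits into limits; after transposition it
is preservation of the colimit by `tensorRight Z`. -/
lemma exists_pre_eq {Z A : C} (f : ∀ k, Z ⟶ (ihom (G.obj k)).obj A)
    (hf : ∀ ⦃k l : K⦄ (u : k ⟶ l), f l ≫ (MonoidalClosed.pre (G.map u)).app A = f k) :
    ∃ g : Z ⟶ (ihom c.pt).obj A, ∀ k, g ≫ (MonoidalClosed.pre (c.ι.app k)).app A = f k := by
  let s : Cocone (G ⋙ tensorRight Z) :=
    { pt := A
      ι :=
        { app := fun k ↦ MonoidalClosed.uncurry (f k)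
          naturality := fun k l u ↦ by
            have := congr(MonoidalClosed.uncurry $(hf u))
            rw [MonoidalClosed.uncurry_pre_app] at this
            simpa using this } }
  refine ⟨MonoidalClosed.curry ((isColimitOfPreserves (tensorRight Z) hc).desc s), fun k ↦ ?_⟩
  apply MonoidalClosed.uncurry_injective
  rw [MonoidalClosed.uncurry_pre_app, MonoidalClosed.uncurry_curry]
  exact (isColimitOfPreserves (tensorRight Z) hc).fac s k

end Tensor

end DiscreteTheory

namespace DiscreteTheory

/-! ### Naturality of internal composition. -/

section Composition

variable {C : Type u} [Category.{w} C] [MonoidalCategory C] [MonoidalClosed C]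

lemma whiskerLeft_ihom_map_comp (X Y : C) {A B : C} (f : A ⟶ B) :
    (ihom X).obj Y ◁ (ihom Y).map f ≫ MonoidalClosed.comp X Y B =
      MonoidalClosed.comp X Y A ≫ (ihom X).map f := by
  apply MonoidalClosed.uncurry_injective
  rw [MonoidalClosed.uncurry_natural_left, MonoidalClosed.uncurry_natural_right,
    MonoidalClosed.comp_eq, MonoidalClosed.comp_eq, MonoidalClosed.uncurry_curry,
    MonoidalClosed.uncurry_curry, MonoidalClosed.compTranspose_eq,
    MonoidalClosed.compTranspose_eq]
  rw [associator_inv_naturality_right_assoc, whisker_exchange_assoc, Category.assoc,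
    Category.assoc]
  exact congr(_ ≫ _ ≫ $(ihom.ev_naturality Y f))

/-- Extranaturality in the middle variable, which moves an algebra morphism from one factor of a
composition to the other. -/
lemma whiskerLeft_pre_comp (X : C) {A A' : C} (B : C) (f : A ⟶ A') :
    (ihom X).obj A ◁ (MonoidalClosed.pre f).app B ≫ MonoidalClosed.comp X A B =
      (ihom X).map f ▷ (ihom A').obj B ≫ MonoidalClosed.comp X A' B := by
  apply MonoidalClosed.uncurry_injective
  rw [MonoidalClosed.uncurry_natural_left, MonoidalClosed.uncurry_natural_left,
    MonoidalClosed.comp_eq, MonoidalClosed.comp_eq, MonoidalClosed.uncurry_curry,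
    MonoidalClosed.uncurry_curry, MonoidalClosed.compTranspose_eq,
    MonoidalClosed.compTranspose_eq, associator_inv_naturality_right_assoc,
    whisker_exchange_assoc, associator_inv_naturality_middle_assoc, ← comp_whiskerRight_assoc,
    ihom.ev_naturality, comp_whiskerRight_assoc]
  exact congr(_ ≫ _ ≫ $(MonoidalClosed.id_tensor_pre_app_comp_ev f B))

end Composition

namespace Pretheory

variable {C : Type u} [Category.{w} C] [MonoidalCategory C] [MonoidalClosed C]
  {κ : Cardinal.{w}} [Fact κ.IsRegular] {T : Pretheory C κ}

namespace Algebra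

@[simp]
lemma id_hom (A : T.Algebra) : Hom.hom (𝟙 A) = 𝟙 A.carrier := rfl

@[simp]
lemma comp_hom {A B D : T.Algebra} (f : A ⟶ B) (g : B ⟶ D) :
    Hom.hom (f ≫ g) = Hom.hom f ≫ Hom.hom g := rfl

lemma hom_ext {A B : T.Algebra} {f g : A ⟶ B} (h : Hom.hom f = Hom.hom g) : f = g :=
  Hom.ext h

lemma Hom.comm' {A B : T.Algebra} (f : A ⟶ B) (X Y : Arity C κ) :
    A.act X Y ≫ (ihom X.obj).map (Hom.hom f) =
      T.cat.Hom X Y ◁ (ihom Y.obj).map (Hom.hom f) ≫ B.act X Y :=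
  Hom.comm f X Y

/-! ### Colimits of algebras, formed on carriers. -/

section Colimit

variable {K : Type*} [Category* K] [∀ Y : Arity C κ, PreservesColimitsOfShape K (ihom Y.obj)]
  (D : K ⥤ T.Algebra) {c : Cocone (D ⋙ T.forget)} (hc : IsColimit c)

/-- The coprojections of a colimit of carriers of algebras. -/
def leg (c : Cocone (D ⋙ T.forget)) (k : K) : (D.obj k).carrier ⟶ c.pt := c.ι.app k

omit [∀ Y : Arity C κ, PreservesColimitsOfShape K (ihom Y.obj)] in
lemma map_leg (c : Cocone (D ⋙ T.forget)) {k l : K} (u : k ⟶ l) :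
    Hom.hom (D.map u) ≫ leg D c l = leg D c k := c.w u

include hc in
lemma leg_hom_ext {P W : C} {Y : Arity C κ} {f g : P ⊗ (ihom Y.obj).obj c.pt ⟶ W}
    (h : ∀ k, P ◁ (ihom Y.obj).map (leg D c k) ≫ f =
      P ◁ (ihom Y.obj).map (leg D c k) ≫ g) : f = g :=
  whiskerLeft_ihom_map_hom_ext hc h

/-- The operations on a colimit of carriers of algebras. -/
noncomputable def colimitAct (X Y : Arity C κ) :
    T.cat.Hom X Y ⊗ (ihom Y.obj).obj c.pt ⟶ (ihom X.obj).obj c.pt :=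
  (isColimitOfPreserves (ihom Y.obj ⋙ tensorLeft (T.cat.Hom X Y)) hc).desc
    { pt := (ihom X.obj).obj c.pt
      ι :=
        { app := fun k ↦ (D.obj k).act X Y ≫ (ihom X.obj).map (leg D c k)
          naturality := fun k l u ↦ by
            dsimp [forget]
            rw [Category.comp_id, ← reassoc_of% Hom.comm', ← Functor.map_comp, map_leg] } }

lemma leg_colimitAct (X Y : Arity C κ) (k : K) :
    T.cat.Hom X Y ◁ (ihom Y.obj).map (leg D c k) ≫ colimitAct D hc X Y =
      (D.obj k).act X Y ≫ (ihom X.obj).map (leg D c k) :=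
  (isColimitOfPreserves (ihom Y.obj ⋙ tensorLeft (T.cat.Hom X Y)) hc).fac _ k

/-- The algebra structure on a colimit of carriers of algebras. -/
@[simps carrier]
noncomputable def colimitAlgebra : T.Algebra where
  carrier := c.pt
  act X Y := colimitAct D hc X Y
  -- Each axiom equates two morphisms out of some `P ⊗ [-, c.pt]`, so it can be checked on the legs,
  -- where it reduces to the axiom of `D.obj k`. The unit law needs its left unitor cancelled first
  -- to take this shape.
  id_act X := by
    rw [← cancel_epi (λ_ _).hom]
    refine leg_hom_ext D hc fun k ↦ ?_
    rw [Iso.hom_inv_id_assoc, whisker_exchange_assoc, leg_colimitAct, Category.comp_id,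
      leftUnitor_naturality, ← cancel_epi (λ_ _).inv, reassoc_of% (D.obj k).id_act X,
      Iso.inv_hom_id_assoc]
  comp_act X Y Z := by
    refine leg_hom_ext D hc fun k ↦ ?_
    rw [whisker_exchange_assoc, leg_colimitAct, reassoc_of% (D.obj k).comp_act X Y Z,
      associator_naturality_right_assoc, ← whiskerLeft_comp_assoc, leg_colimitAct,
      whiskerLeft_comp_assoc, leg_colimitAct]
  J_act X Y := by
    refine leg_hom_ext D hc fun k ↦ ?_
    rw [whisker_exchange_assoc, leg_colimitAct, reassoc_of% (D.obj k).J_act X Y,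
      whiskerLeft_ihom_map_comp]

/-- The cocone of algebras with point `colimitAlgebra`. -/
noncomputable def colimitCocone : Cocone D where
  pt := colimitAlgebra D hc
  ι :=
    { app := fun k ↦ Hom.mk (A := D.obj k) (B := colimitAlgebra D hc) (leg D c k)
        fun X Y ↦ (leg_colimitAct D hc X Y k).symm
      naturality := fun _ _ u ↦ hom_ext ((map_leg D c u).trans (Category.comp_id _).symm) }

/-- The cocone `colimitCocone` is a colimit. -/
noncomputable def isColimitColimitCocone : IsColimit (colimitCocone D hc) where
  desc s :=
    let d : c.pt ⟶ s.pt.carrier := hc.desc (T.forget.mapCocone s)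
    have h (k : K) : leg D c k ≫ d = Hom.hom (s.ι.app k) := hc.fac (T.forget.mapCocone s) k
    Hom.mk (A := colimitAlgebra D hc) (B := s.pt) d fun X Y ↦ by
      refine leg_hom_ext D hc fun k ↦ ?_
      have h' := Hom.comm' (s.ι.app k) X Y
      dsimp at h'
      rw [← h, Functor.map_comp, Functor.map_comp, whiskerLeft_comp_assoc] at h'
      exact (reassoc_of% leg_colimitAct D hc X Y k) _ |>.trans h'
  fac s k := hom_ext (hc.fac (T.forget.mapCocone s) k)
  uniq s m hm := hom_ext (hc.uniq (T.forget.mapCocone s) _ fun k ↦ congr(Hom.hom $(hm k)))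

end Colimit

end Algebra

section

variable {K : Type*} [Category* K] [∀ Y : Arity C κ, PreservesColimitsOfShape K (ihom Y.obj)]
  [HasColimitsOfShape K C]

instance : HasColimitsOfShape K T.Algebra where
  has_colimit D := ⟨_, Algebra.isColimitColimitCocone D (colimit.isColimit (D ⋙ T.forget))⟩

instance : PreservesColimitsOfShape K T.forget where
  preservesColimit {D} := preservesColimit_of_preserves_colimit_cocone
    (Algebra.isColimitColimitCocone D (colimit.isColimit (D ⋙ T.forget)))
    (IsColimit.ofIsoColimit (colimit.isColimit (D ⋙ T.forget)) (Cocone.ext (Iso.refl _)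
      fun _ ↦ Category.comp_id _))

end

end Pretheory

end DiscreteTheory

namespace DiscreteTheory

namespace Pretheory

variable {C : Type u} [Category.{w} C] [MonoidalCategory C] [MonoidalClosed C]
  {κ : Cardinal.{w}} [Fact κ.IsRegular] {T : Pretheory C κ}

namespace Algebra

/-! ### Generalized elements of hom-objects of algebras, and free algebras. -/

section Graded

variable {A A' B : T.Algebra} {Z : C}

/-- Restriction of a graded morphism along an algebra morphism, on the side of the source of the
operations. -/
lemma whiskerRight_act_comp (f : A ⟶ A') (h : Z ⟶ (ihom A'.carrier).obj B.carrier)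
    (X Y : Arity C κ) :
    (T.cat.Hom X Y ◁ (ihom Y.obj).map (Hom.hom f)) ▷ Z ≫ A'.act X Y ▷ Z ≫ (_ ◁ h) ≫
        MonoidalClosed.comp X.obj A'.carrier B.carrier =
      A.act X Y ▷ Z ≫ (_ ◁ (h ≫ (MonoidalClosed.pre (Hom.hom f)).app B.carrier)) ≫
        MonoidalClosed.comp X.obj A.carrier B.carrier := by
  rw [← comp_whiskerRight_assoc, ← Hom.comm', whiskerLeft_comp_assoc, whiskerLeft_pre_comp,
    comp_whiskerRight_assoc, whisker_exchange_assoc]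

lemma whiskerLeft_comp_act (f : A ⟶ A') (h : Z ⟶ (ihom A'.carrier).obj B.carrier)
    (X Y : Arity C κ) :
    (T.cat.Hom X Y ◁ (ihom Y.obj).map (Hom.hom f)) ▷ Z ≫ (α_ _ _ _).hom ≫
        T.cat.Hom X Y ◁ ((_ ◁ h) ≫ MonoidalClosed.comp Y.obj A'.carrier B.carrier) ≫ B.act X Y =
      (α_ _ _ _).hom ≫ T.cat.Hom X Y ◁
        ((_ ◁ (h ≫ (MonoidalClosed.pre (Hom.hom f)).app B.carrier)) ≫
          MonoidalClosed.comp Y.obj A.carrier B.carrier) ≫ B.act X Y := by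
  rw [whiskerLeft_comp (ihom Y.obj |>.obj A.carrier), Category.assoc, whiskerLeft_pre_comp,
    associator_naturality_middle_assoc, ← whiskerLeft_comp_assoc, whisker_exchange_assoc]

lemma IsGradedHom.comp_pre {h : Z ⟶ (ihom A'.carrier).obj B.carrier} (hh : IsGradedHom A' B h)
    (f : A ⟶ A') :
    IsGradedHom A B (h ≫ (MonoidalClosed.pre (Hom.hom f)).app B.carrier) := fun X Y ↦ by
  rw [← whiskerRight_act_comp, hh X Y, whiskerLeft_comp_act]

/-- The case `Z = I`, where the parameter disappears through the right unitor. -/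
lemma isGradedHom_curry'_iff (f : A.carrier ⟶ B.carrier) :
    IsGradedHom A B (MonoidalClosed.curry' f) ↔ ∀ X Y : Arity C κ,
      A.act X Y ≫ (ihom X.obj).map f = T.cat.Hom X Y ◁ (ihom Y.obj).map f ≫ B.act X Y := by
  refine forall₂_congr fun X Y ↦ ?_
  rw [MonoidalClosed.whiskerLeft_curry'_comp, MonoidalClosed.whiskerLeft_curry'_comp,
    rightUnitor_naturality_assoc, whiskerLeft_comp_assoc, ← rightUnitor_tensor_hom_assoc,
    cancel_epi]

end Graded

namespace IsFree

variable {F : T.Algebra} {X : C} {η : X ⟶ F.carrier}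

/-- The ordinary universal property is enriched freeness at the shape `Z = I`. -/
lemma existsUnique_hom (hF : F.IsFree η) (A : T.Algebra) (y : X ⟶ A.carrier) :
    ∃! f : F ⟶ A, η ≫ Hom.hom f = y := by
  have key (f : F.carrier ⟶ A.carrier) :
      MonoidalClosed.curry' f ≫ (MonoidalClosed.pre η).app A.carrier =
        MonoidalClosed.curry' (η ≫ f) := by
    rw [MonoidalClosed.curry', MonoidalClosed.curry_pre_app, rightUnitor_naturality_assoc]
    rfl
  obtain ⟨h, ⟨h₁, h₂⟩, h₃⟩ := hF A (𝟙_ C) (MonoidalClosed.curry' y)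
  obtain ⟨f, rfl⟩ := MonoidalClosed.curryHomEquiv'.surjective h
  replace h₁ := (isGradedHom_curry'_iff f).1 h₁
  refine ⟨Hom.mk f h₁, MonoidalClosed.curry'_injective ((key f).symm.trans h₂), fun g hg ↦ ?_⟩
  refine hom_ext (MonoidalClosed.curry'_injective (h₃ _ ⟨?_, ?_⟩))
  · exact (isGradedHom_curry'_iff _).2 (Hom.comm g)
  · rw [key, hg]

/-- The bijection between algebra morphisms out of a free algebra and morphisms out of the
generating object. -/
noncomputable def homEquiv (hF : F.IsFree η) (A : T.Algebra) : (F ⟶ A) ≃ (X ⟶ A.carrier) :=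
  Equiv.ofBijective (fun f ↦ η ≫ Hom.hom f)
    ((Function.bijective_iff_existsUnique _).2 (hF.existsUnique_hom A))

lemma leftAdjointObjIsDefined (hF : F.IsFree η) : T.forget.leftAdjointObjIsDefined X :=
  Functor.CorepresentableBy.isCorepresentable (X := F)
    { homEquiv := hF.homEquiv _
      homEquiv_comp := fun g f ↦ (Category.assoc η (Hom.hom f) (Hom.hom g)).symm }

end IsFree

/-- Two algebras with the universal property of the free algebra on an object are isomorphic. -/
lemma exists_iso_of_existsUnique {X : C} {F F' : T.Algebra} {η : X ⟶ F.carrier}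
    {η' : X ⟶ F'.carrier}
    (hF : ∀ (A : T.Algebra) (y : X ⟶ A.carrier), ∃! f : F ⟶ A, η ≫ Hom.hom f = y)
    (hF' : ∀ (A : T.Algebra) (y : X ⟶ A.carrier), ∃! f : F' ⟶ A, η' ≫ Hom.hom f = y) :
    ∃ e : F ≅ F', η ≫ Hom.hom e.hom = η' := by
  obtain ⟨f, hf, -⟩ := hF F' η'
  obtain ⟨g, hg, -⟩ := hF' F η
  refine ⟨⟨f, g, (hF F η).unique ?_ ?_, (hF' F' η').unique ?_ ?_⟩, hf⟩ <;>
    simp [reassoc_of% hf, reassoc_of% hg, hf, hg]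

end Algebra

end Pretheory

end DiscreteTheory

namespace DiscreteTheory

namespace Pretheory

/-! ### Operations as elements of free algebras. -/

section Interpretation

variable {C : Type u} [Category.{w} C] [MonoidalCategory C] [MonoidalClosed C]
  {κ : Cardinal.{w}} [Fact κ.IsRegular] {T : Pretheory C κ}

namespace Algebra

variable {A B : T.Algebra} {X Y Z : Arity C κ}

lemma eval_naturality (φ : A ⟶ B) (y : Y.obj ⟶ A.carrier) :
    A.eval X Y y ≫ (ihom X.obj).map (Hom.hom φ) = B.eval X Y (y ≫ Hom.hom φ) := by
  simp only [eval, Category.assoc]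
  rw [Hom.comm', ← whiskerLeft_comp_assoc, MonoidalClosed.curry'_ihom_map]

lemma interp_naturality (φ : A ⟶ B) (f : 𝟙_ C ⟶ T.cat.Hom X Y) (y : Y.obj ⟶ A.carrier) :
    A.interp f y ≫ Hom.hom φ = B.interp f (y ≫ Hom.hom φ) := by
  apply MonoidalClosed.curry'_injective
  simp only [interp]
  rw [← MonoidalClosed.curry'_ihom_map, MonoidalClosed.curry'_uncurry',
    MonoidalClosed.curry'_uncurry', Category.assoc, eval_naturality]

lemma curry'_interp (f : 𝟙_ C ⟶ T.cat.Hom X Y) (y : Y.obj ⟶ A.carrier) :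
    MonoidalClosed.curry' (A.interp f y) =
      (λ_ (𝟙_ C)).inv ≫ (f ⊗ₘ MonoidalClosed.curry' y) ≫ A.act X Y := by
  simp only [interp, eval, MonoidalClosed.curry'_uncurry']
  rw [rightUnitor_inv_naturality_assoc, unitors_inv_equal, tensorHom_def_assoc]

lemma interp_mapJ (f : X.obj ⟶ Y.obj) (y : Y.obj ⟶ A.carrier) :
    A.interp (T.mapJ f) y = f ≫ y := by
  apply MonoidalClosed.curry'_injective
  rw [curry'_interp, MonoidalClosed.curry'_comp, ← A.J_act, mapJ, tensorHom_def_assoc,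
    tensorHom_def_assoc, comp_whiskerRight_assoc, whisker_exchange_assoc]

lemma interp_underlyingComp (f : 𝟙_ C ⟶ T.cat.Hom X Y) (g : 𝟙_ C ⟶ T.cat.Hom Y Z)
    (z : Z.obj ⟶ A.carrier) :
    A.interp (T.underlyingComp f g) z = A.interp f (A.interp g z) := by
  apply MonoidalClosed.curry'_injective
  rw [curry'_interp, curry'_interp, curry'_interp, underlyingComp]
  -- `h₁` and `h₂` pull the unitors out of the tensor so that `comp_act` applies; only coherence
  -- remains.
  have h₁ : ((λ_ (𝟙_ C)).inv ≫ (f ⊗ₘ g) ≫ T.cat.comp X Y Z) ⊗ₘ MonoidalClosed.curry' z =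
      (λ_ (𝟙_ C)).inv ▷ 𝟙_ C ≫ ((f ⊗ₘ g) ⊗ₘ MonoidalClosed.curry' z) ≫
        T.cat.comp X Y Z ▷ _ := by
    simp only [← tensorHom_id, tensorHom_comp_tensorHom, Category.id_comp, Category.comp_id]
  have h₂ : f ⊗ₘ ((λ_ (𝟙_ C)).inv ≫ (g ⊗ₘ MonoidalClosed.curry' z) ≫ A.act Y Z) =
      𝟙_ C ◁ (λ_ (𝟙_ C)).inv ≫ (f ⊗ₘ (g ⊗ₘ MonoidalClosed.curry' z)) ≫
        T.cat.Hom X Y ◁ A.act Y Z := by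
    simp only [← id_tensorHom, tensorHom_comp_tensorHom, Category.id_comp, Category.comp_id]
  rw [h₁, h₂]
  simp only [Category.assoc, A.comp_act, associator_naturality_assoc]
  monoidal

lemma interp_bijective (y : Y.obj ⟶ A.carrier) [IsIso (A.eval X Y y)] :
    Function.Bijective fun f : 𝟙_ C ⟶ T.cat.Hom X Y ↦ A.interp f y :=
  MonoidalClosed.curryHomEquiv'.symm.bijective.comp
    (((asIso (A.eval X Y y)).homToEquiv (Z := 𝟙_ C)).bijective)

lemma isIso_eval_of_iso (e : A ≅ B) (y : Y.obj ⟶ A.carrier) [IsIso (A.eval X Y y)] :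
    IsIso (B.eval X Y (y ≫ Hom.hom e.hom)) := by
  rw [← eval_naturality]
  have : IsIso (Hom.hom e.hom) := inferInstanceAs (IsIso (T.forget.map e.hom))
  infer_instance

lemma IsFree.of_iso {F F' : T.Algebra} {X : C} {η : X ⟶ F.carrier} (hF : F.IsFree η) (e : F ≅ F') :
    F'.IsFree (η ≫ Hom.hom e.hom) := fun A Z g ↦ by
  have key : (MonoidalClosed.pre (Hom.hom e.hom)).app A.carrier ≫
      (MonoidalClosed.pre (Hom.hom e.inv)).app A.carrier = 𝟙 _ := by
    rw [← NatTrans.comp_app, ← MonoidalClosed.pre_map, ← comp_hom, e.inv_hom_id]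
    simp
  have key' : (MonoidalClosed.pre (Hom.hom e.inv)).app A.carrier ≫
      (MonoidalClosed.pre (Hom.hom e.hom)).app A.carrier = 𝟙 _ := by
    rw [← NatTrans.comp_app, ← MonoidalClosed.pre_map, ← comp_hom, e.hom_inv_id]
    simp
  obtain ⟨h, ⟨h₁, h₂⟩, h₃⟩ := hF A Z g
  refine ⟨h ≫ (MonoidalClosed.pre (Hom.hom e.inv)).app A.carrier, ⟨h₁.comp_pre e.inv, ?_⟩,
    fun h' hh' ↦ ?_⟩
  · simp [MonoidalClosed.pre_map, reassoc_of% key', h₂]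
  · rw [← h₃ _ ⟨hh'.1.comp_pre e.hom, ?_⟩, Category.assoc, key, Category.comp_id]
    simpa [MonoidalClosed.pre_map] using hh'.2

end Algebra

/-- `IsTheory` speaks of one chosen free algebra on `Y`; uniqueness up to isomorphism carries the
property over to any other. -/
lemma IsTheory.interp_bijective (hT : T.IsTheory) {F : T.Algebra} {Y : Arity C κ}
    {η : Y.obj ⟶ F.carrier} (hF : F.IsFree η) (X : Arity C κ) :
    Function.Bijective fun f : 𝟙_ C ⟶ T.cat.Hom X Y ↦ F.interp f η := by
  obtain ⟨F', η', hF', h⟩ := hT Y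
  obtain ⟨e, rfl⟩ := Algebra.exists_iso_of_existsUnique hF'.existsUnique_hom hF.existsUnique_hom
  have := h X
  have := Algebra.isIso_eval_of_iso (X := X) e η'
  exact Algebra.interp_bijective _

end Interpretation

/-! ### Existence of the enriched left adjoint. -/

section Existence

variable {C : Type u} [Category.{w} C] [MonoidalCategory C] [SymmetricCategory C]
  [MonoidalClosed C] {κ : Cardinal.{w}} [Fact κ.IsRegular] {T : Pretheory C κ}

namespace Algebra.IsFree

/-- Enriched freeness passes to colimits that are preserved by the forgetful functor. -/
lemma of_isColimit {K : Type*} [Category* K]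
    [∀ Y : Arity C κ, PreservesColimitsOfShape K (ihom Y.obj)] {R : K ⥤ C} {c : Cocone R}
    (hc : IsColimit c) {D : K ⥤ T.Algebra} {s : Cocone D} (hs : IsColimit (T.forget.mapCocone s))
    (η : ∀ k, R.obj k ⟶ (D.obj k).carrier)
    (hη : ∀ ⦃k l : K⦄ (u : k ⟶ l), η k ≫ Hom.hom (D.map u) = R.map u ≫ η l)
    (η' : c.pt ⟶ s.pt.carrier) (hη' : ∀ k, η k ≫ Hom.hom (s.ι.app k) = c.ι.app k ≫ η')
    (h : ∀ k, (D.obj k).IsFree (η k)) :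
    s.pt.IsFree η' := fun A Z g ↦ by
  have pre_comp {X Y W : C} (u : X ⟶ Y) (v : Y ⟶ W) (x : Z ⟶ (ihom W).obj A.carrier) :
      (x ≫ (MonoidalClosed.pre v).app A.carrier) ≫ (MonoidalClosed.pre u).app A.carrier =
        x ≫ (MonoidalClosed.pre (u ≫ v)).app A.carrier := by
    simp [MonoidalClosed.pre_map]
  choose f hf hf' using fun k ↦ h k A Z (g ≫ (MonoidalClosed.pre (c.ι.app k)).app A.carrier)
  -- Uniqueness at stage `k` forces the chosen graded morphisms to be compatible, so they glue along
  -- the colimit.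
  have hfmap ⦃k l : K⦄ (u : k ⟶ l) :
      f l ≫ (MonoidalClosed.pre (Hom.hom (D.map u))).app A.carrier = f k := by
    refine hf' k _ ⟨(hf l).1.comp_pre (D.map u), ?_⟩
    rw [pre_comp, hη, ← pre_comp, (hf l).2, pre_comp, c.w]
  obtain ⟨d, hd⟩ : ∃ d : Z ⟶ (ihom s.pt.carrier).obj A.carrier,
      ∀ k, d ≫ (MonoidalClosed.pre (Hom.hom (s.ι.app k))).app A.carrier = f k :=
    exists_pre_eq hs f hfmap
  refine ⟨d, ⟨fun X Y ↦ ?_, ?_⟩, fun d' ⟨hd₁, hd₂⟩ ↦ ?_⟩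
  · refine whiskerLeft_ihom_map_whiskerRight_hom_ext hs fun k ↦ ?_
    refine (whiskerRight_act_comp (s.ι.app k) d X Y).trans
      (Eq.trans ?_ (whiskerLeft_comp_act (s.ι.app k) d X Y).symm)
    have := (hf k).1 X Y
    rw [← hd k] at this
    exact this
  · refine pre_hom_ext hc fun k ↦ ?_
    rw [pre_comp, ← hη', ← pre_comp, hd, (hf k).2]
  · refine pre_hom_ext hs fun k ↦ Eq.trans ?_ (hd k).symm
    refine hf' k _ ⟨hd₁.comp_pre (s.ι.app k), ?_⟩
    exact (pre_comp _ _ d').trans (by rw [← hd₂, pre_comp, ← hη']; rfl)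

end Algebra.IsFree

variable [IsLocallyPresentableMonoidal C κ]

instance (K : Type w) [SmallCategory K] [IsCardinalFiltered K κ] (Y : Arity C κ) :
    PreservesColimitsOfShape K (ihom Y.obj) :=
  (ihom Y.obj).preservesColimitsOfShape_of_isCardinalAccessible κ K

instance : T.forget.IsCardinalAccessible κ where

omit [SymmetricCategory C] in
-- Every object is a `κ`-filtered colimit of arities, which have free algebras, and a partially
-- defined left adjoint extends along colimits that exist among algebras.
lemma IsTheory.isRightAdjoint_forget (hT : T.IsTheory) : T.forget.IsRightAdjoint := by
  refine Functor.isRightAdjoint_of_leftAdjointObjIsDefined_eq_top (eq_top_iff.2 fun X _ ↦ ?_)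
  obtain ⟨P, _, hP⟩ := HasCardinalFilteredGenerator.exists_generator C κ
  obtain ⟨K, _, _, ⟨p⟩⟩ := hP.exists_colimitsOfShape X
  refine Functor.leftAdjointObjIsDefined_of_isColimit p.isColimit fun k ↦ ?_
  obtain ⟨F, η, hF, -⟩ := hT ⟨p.diag.obj k, hP.le_isCardinalPresentable _ (p.prop_diag_obj k)⟩
  exact hF.leftAdjointObjIsDefined

omit [SymmetricCategory C] [IsLocallyPresentableMonoidal C κ] in
lemma existsUnique_hom_of_adjunction {F : C ⥤ T.Algebra} (adj : F ⊣ T.forget) (X : C)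
    (A : T.Algebra) (y : X ⟶ A.carrier) :
    ∃! f : F.obj X ⟶ A, adj.unit.app X ≫ Algebra.Hom.hom f = y := by
  have h (f : F.obj X ⟶ A) :
      adj.homEquiv X A f = adj.unit.app X ≫ Algebra.Hom.hom f := adj.homEquiv_unit _ _ f
  obtain ⟨f, hf, hu⟩ := (adj.homEquiv X A).bijective.existsUnique y
  exact ⟨f, (h f).symm.trans hf, fun g hg ↦ hu g ((h g).trans hg)⟩

lemma IsTheory.nonempty_freeAlgebras (hT : T.IsTheory) : Nonempty T.FreeAlgebras := by
  have := hT.isRightAdjoint_forget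
  let F := T.forget.leftAdjoint
  let adj : F ⊣ T.forget := Adjunction.ofIsRightAdjoint T.forget
  have hunit {X Y : C} (f : X ⟶ Y) :
      adj.unit.app X ≫ Algebra.Hom.hom (F.map f) = f ≫ adj.unit.app Y :=
    (adj.unit.naturality f).symm
  -- The adjunction is only an ordinary one. Enriched freeness is imported from `hT` on arities,
  -- then spread by `κ`-filtered colimits, which both `F` and `T.forget` preserve.
  have hArity (Y : Arity C κ) : (F.obj Y.obj).IsFree (adj.unit.app Y.obj) := by
    obtain ⟨F', η, hF', -⟩ := hT Y
    obtain ⟨e, he⟩ := Algebra.exists_iso_of_existsUnique hF'.existsUnique_hom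
      (existsUnique_hom_of_adjunction adj Y.obj)
    rw [← he]
    exact hF'.of_iso e
  refine ⟨⟨F, adj, fun X ↦ ?_⟩⟩
  obtain ⟨P, _, hP⟩ := HasCardinalFilteredGenerator.exists_generator C κ
  obtain ⟨K, _, _, ⟨p⟩⟩ := hP.exists_colimitsOfShape X
  have := T.forget.preservesColimitsOfShape_of_isCardinalAccessible κ K
  have : PreservesColimitsOfSize.{w, w} F := adj.leftAdjoint_preservesColimits
  exact Algebra.IsFree.of_isColimit p.isColimit
    (isColimitOfPreserves T.forget (isColimitOfPreserves F p.isColimit))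
    (fun k ↦ adj.unit.app (p.diag.obj k)) (fun k l u ↦ hunit _) (adj.unit.app X)
    (fun k ↦ hunit _)
    (fun k ↦ hArity ⟨p.diag.obj k, hP.le_isCardinalPresentable _ (p.prop_diag_obj k)⟩)

end Existence

end Pretheory

end DiscreteTheory

namespace DiscreteTheory

/-! ### Discreteness and preservation of surjections. -/

lemma ι_δ {C : Type u} [Category.{w} C] [MonoidalCategory C] [HasCoproducts.{w} C] (X : C)
    (x : 𝟙_ C ⟶ X) : (Sigma.ι (fun _ : 𝟙_ C ⟶ X ↦ 𝟙_ C) x : 𝟙_ C ⟶ discreteObj X) ≫ δ X = x :=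
  Sigma.ι_desc _ _

lemma surjections_δ {C : Type u} [Category.{w} C] [MonoidalCategory C] [HasCoproducts.{w} C]
    (X : C) : surjections C (δ X) := fun x ↦ ⟨_, ι_δ X x⟩

/-- Discrete objects lift along surjections. -/
lemma exists_discreteObj_lift {C : Type u} [Category.{w} C] [MonoidalCategory C]
    [HasCoproducts.{w} C] {A B X : C} {q : A ⟶ B} (hq : surjections C q) (b : X ⟶ B) :
    ∃ a : discreteObj X ⟶ A, a ≫ q = δ X ≫ b := by
  choose r hr using hq
  exact ⟨Sigma.desc fun z : 𝟙_ C ⟶ X ↦ r (z ≫ b), Sigma.hom_ext _ _ fun z ↦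
    (Sigma.ι_desc_assoc ..).trans ((hr (z ≫ b)).trans
      ((congr($(ι_δ X z) ≫ b)).symm.trans (Category.assoc _ _ _)))⟩

namespace Pretheory

variable {C : Type u} [Category.{w} C] [MonoidalCategory C] [MonoidalClosed C]
  {κ : Cardinal.{w}} [Fact κ.IsRegular] {T : Pretheory C κ}

namespace FreeAlgebras

variable (L : T.FreeAlgebras)

/-- The unit of the adjunction of free algebras. -/
def unit (X : C) : X ⟶ (L.F.obj X).carrier := L.adj.unit.app X

lemma unit_naturality {X Y : C} (f : X ⟶ Y) :
    L.unit X ≫ Algebra.Hom.hom (L.F.map f) = f ≫ L.unit Y :=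
  (L.adj.unit.naturality f).symm

/-- Two algebra morphisms out of a free algebra are equal if and only if they agree on
generators. -/
lemma hom_eq_iff {X : C} {A : T.Algebra} (f g : L.F.obj X ⟶ A) :
    f = g ↔ L.unit X ≫ Algebra.Hom.hom f = L.unit X ≫ Algebra.Hom.hom g :=
  ⟨fun h ↦ by rw [h], fun h ↦ (existsUnique_hom_of_adjunction L.adj X A _).unique h rfl⟩

lemma unit_homOfOp {X Y : Arity C κ} (f : 𝟙_ C ⟶ T.cat.Hom X Y) :
    L.unit X.obj ≫ Algebra.Hom.hom (L.homOfOp f) =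
      (L.F.obj Y.obj).interp f (L.unit Y.obj) := by
  have h : L.adj.homEquiv X.obj (L.F.obj Y.obj) (L.homOfOp f) =
      L.unit X.obj ≫ Algebra.Hom.hom (L.homOfOp f) := L.adj.homEquiv_unit _ _ _
  rw [← h]
  exact Equiv.apply_symm_apply _ _

lemma interp_unit_bijective (hT : T.IsTheory) (X Y : Arity C κ) :
    Function.Bijective fun f : 𝟙_ C ⟶ T.cat.Hom X Y ↦ (L.F.obj Y.obj).interp f (L.unit Y.obj) :=
  hT.interp_bijective (L.isFree Y.obj) X

variable [IsLocallyPresentableMonoidal C κ]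

lemma monad_isCardinalAccessible : L.monad.toFunctor.IsCardinalAccessible κ := by
  have : PreservesColimitsOfSize.{w, w} L.F := L.adj.leftAdjoint_preservesColimits
  exact inferInstanceAs ((L.F ⋙ T.forget).IsCardinalAccessible κ)

/-- Transposing along the free algebra adjunction trades morphisms out of `F I` for points of
carriers, the form in which surjections are defined. -/
lemma isDiscrete_iff : T.IsDiscrete L ↔
    ∀ (X : Arity C κ) (f : 𝟙_ C ⟶ T.cat.Hom (Arity.unit C κ) X),
      ∃ g : 𝟙_ C ⟶ (L.F.obj (discreteObj X.obj)).carrier,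
        g ≫ Algebra.Hom.hom (L.F.map (δ X.obj)) =
          (L.F.obj X.obj).interp f (L.unit X.obj) := by
  refine forall₂_congr fun X f ↦ ⟨fun ⟨g, hg⟩ ↦ ⟨L.unit _ ≫ Algebra.Hom.hom g, ?_⟩,
    fun ⟨g, hg⟩ ↦ ?_⟩
  · rw [Category.assoc, ← Algebra.comp_hom, hg]
    exact L.unit_homOfOp f
  · obtain ⟨g, rfl, -⟩ := existsUnique_hom_of_adjunction L.adj _ _ g
    refine ⟨g, (L.hom_eq_iff _ _).2 (Eq.trans ?_ (hg.trans (L.unit_homOfOp f).symm))⟩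
    exact (Category.assoc _ _ _).symm

lemma isDiscrete_of_preservesSurjections
    (h : PreservesSurjections C L.monad.toFunctor) : T.IsDiscrete L :=
  L.isDiscrete_iff.2 fun X _ ↦ h _ (surjections_δ X.obj) _

lemma preservesSurjections_of_isDiscrete (hT : T.IsTheory) (h : T.IsDiscrete L) :
    PreservesSurjections C L.monad.toFunctor := by
  intro A B q hq x
  obtain ⟨P, _, hP⟩ := HasCardinalFilteredGenerator.exists_generator C κ
  obtain ⟨K, _, _, ⟨p⟩⟩ := hP.exists_colimitsOfShape B
  have := L.monad_isCardinalAccessible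
  have := L.monad.toFunctor.preservesColimitsOfShape_of_isCardinalAccessible κ K
  have : IsCardinalPresentable (𝟙_ C) κ := IsLocallyPresentableMonoidal.unit_presentable
  -- Discreteness concerns only arities, so the point of `T B` is first brought back to a stage `T
  -- X` with `X` presentable.
  obtain ⟨k, y, rfl⟩ := IsCardinalPresentable.exists_hom_of_isColimit κ
    (isColimitOfPreserves L.monad.toFunctor p.isColimit) x
  let X : Arity C κ := ⟨p.diag.obj k, hP.le_isCardinalPresentable _ (p.prop_diag_obj k)⟩
  let b : X.obj ⟶ B := p.ι.app k
  obtain ⟨g, hg⟩ : ∃ g : 𝟙_ C ⟶ L.monad.toFunctor.obj (discreteObj X.obj),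
      g ≫ L.monad.toFunctor.map (δ X.obj) = y := by
    obtain ⟨f, hf⟩ := (L.interp_unit_bijective hT (Arity.unit C κ) X).surjective y
    obtain ⟨g, hg⟩ := L.isDiscrete_iff.1 h X f
    exact ⟨g, hg.trans hf⟩
  obtain ⟨a, ha⟩ := exists_discreteObj_lift hq b
  refine ⟨g ≫ L.monad.toFunctor.map a, ?_⟩
  change (g ≫ L.monad.toFunctor.map a) ≫ L.monad.toFunctor.map q = y ≫ L.monad.toFunctor.map b
  rw [Category.assoc, ← Functor.map_comp, ha, Functor.map_comp, ← hg, Category.assoc]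

lemma isDiscreteInside_iff (hT : T.IsTheory)
    (h : ∀ X : Arity C κ, IsCardinalPresentable (discreteObj X.obj) κ) :
    T.IsDiscreteInside h ↔ T.IsDiscrete L := by
  rw [isDiscrete_iff]
  refine forall₂_congr fun X f ↦ ?_
  let X₀ : Arity C κ := ⟨discreteObj X.obj, h X⟩
  have hinj := (L.interp_unit_bijective hT (Arity.unit C κ) X).injective
  have hsurj := (L.interp_unit_bijective hT (Arity.unit C κ) X₀).surjective
  -- Under interpretation at the generic element, composing with `J δ_X` in `𝒯` becomes applying `F
  -- δ_X`. Injectivity for `X` and surjectivity for `X₀` then translate between the two conditions.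
  have key (g : 𝟙_ C ⟶ T.cat.Hom (Arity.unit C κ) X₀) :
      (L.F.obj X.obj).interp (T.underlyingComp g (T.mapJ (X := X₀) (Y := X) (δ X.obj)))
        (L.unit X.obj) =
      (L.F.obj X₀.obj).interp g (L.unit X₀.obj) ≫ Algebra.Hom.hom (L.F.map (δ X.obj)) := by
    rw [Algebra.interp_underlyingComp, Algebra.interp_mapJ, Algebra.interp_naturality,
      unit_naturality]
  constructor
  · rintro ⟨g, rfl⟩
    exact ⟨_, (key g).symm⟩
  · rintro ⟨g, hg⟩
    obtain ⟨g, rfl⟩ := hsurj g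
    exact ⟨g, hinj ((key g).trans hg)⟩

end FreeAlgebras

end Pretheory

end DiscreteTheory

theorem theorem3p4 {C : Type u} [CategoryTheory.Category.{w} C]
    [CategoryTheory.MonoidalCategory C] [CategoryTheory.SymmetricCategory C]
    [CategoryTheory.MonoidalClosed C]
    (κ : Cardinal.{w}) [Fact κ.IsRegular] [DiscreteTheory.IsLocallyPresentableMonoidal C κ]
    (T : DiscreteTheory.Pretheory C κ) (hT : T.IsTheory) :
    Nonempty T.FreeAlgebras ∧
    ∀ L : T.FreeAlgebras,
      L.monad.toFunctor.IsCardinalAccessible κ ∧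
      (T.IsDiscrete L ↔ DiscreteTheory.PreservesSurjections C L.monad.toFunctor) ∧
      ∀ h : ∀ X : DiscreteTheory.Arity C κ,
          CategoryTheory.IsCardinalPresentable (DiscreteTheory.discreteObj X.obj) κ,
        (T.IsDiscreteInside h ↔
          DiscreteTheory.PreservesSurjections C L.monad.toFunctor) := by
  refine ⟨hT.nonempty_freeAlgebras, fun L ↦ ?_⟩
  have key : T.IsDiscrete L ↔ DiscreteTheory.PreservesSurjections C L.monad.toFunctor :=
    ⟨L.preservesSurjections_of_isDiscrete hT, L.isDiscrete_of_preservesSurjections⟩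
  exact ⟨L.monad_isCardinalAccessible, key, fun h ↦ (L.isDiscreteInside_iff hT h).trans key⟩
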